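/- Let $\Phi$ be a commutative ring and let $A$ be a semiprime associative (not necessarily unital) $\Phi$-algebra, i.e. $I=0$ for every ideal $I$ of $A$ with $I^2=0$. Let $Q^l_{max}(A)$ be the maximal left quotient algebra of $A$, that is, the algebra of classes $[D,f]$ of homomorphisms of left $A$-modules $f\colon D\to A$ defined on dense left ideals $D$ of $A$ (two being identified when they agree on a dense left ideal), with $A$ embedded by $a\mapsto[A,\rho_a]$, $\rho_a(d)=da$. Let $$Q_s(A)=\{q\in Q^l_{max}(A)\ :\ Iq+qI\subseteq A\text{ for some essential ideal } I \text{ of } A\}$$ be the Martindale symmetric algebra of quotients of $A$. For $x\in Q_s(A)$ and a subalgebra $S$ of $Q_s(A)$ with $xS+Sx\subseteq S$, let $S_x$ be the local algebra of $S$ at $x$: the $\Phi$-module $xSx$ with the product $xsx\cdot xtx=xsxtx$. (1) Let $x\in Q_s(A)$ satisfy $xA+Ax\subseteq A$. Then $x$ is von Neumann regular (there is $y\in Q_s(A)$ with $x=xyx$) if and only if there is an isomorphism of $\Phi$-algebras $Q_s(A_x)\cong Q_s(A)_x$ which is the identity on $A_x$ (where $A_x\subseteq Q_s(A_x)$ canonically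 and $A_x=xAx\subseteq xQ_s(A)x=Q_s(A)_x$). (2) For every idempotent $e\in Q_s(A)$ with $eA+Ae\subseteq A$ there is an isomorphism of $\Phi$-algebras $Q_s(eAe)\cong eQ_s(A)e$ which is the identity on $eAe$. -/

import Mathlib

noncomputable section

namespace Martindale

universe u v

/-! ## Ideals, semiprime algebras, essential ideals -/

section Ideals

variable (Φ : Type v) [CommRing Φ] {A : Type u} [NonUnitalRing A] [Module Φ A]

/-- A `Φ`-submodule of the (not necessarily unital) `Φ`-algebra `A` is a two-sided ideal. -/
def IsIdeal (I : Submodule Φ A) : Prop :=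
  ∀ a : A, ∀ b ∈ I, a * b ∈ I ∧ b * a ∈ I

/-- `A` is semiprime: every ideal `I` with `I² = 0` is zero. -/
class IsSemiprimeAlgebra (Φ : Type v) [CommRing Φ] (A : Type u) [NonUnitalRing A] [Module Φ A] :
    Prop where
  eq_bot_of_sq : ∀ I : Submodule Φ A, IsIdeal Φ I → (∀ a ∈ I, ∀ b ∈ I, a * b = 0) → I = ⊥

/-- An essential ideal: an ideal meeting every nonzero ideal in a nonzero ideal. -/
def IsEssentialIdeal (I : Submodule Φ A) : Prop :=
  IsIdeal Φ I ∧ ∀ J : Submodule Φ A, IsIdeal Φ J → J ≠ ⊥ → I ⊓ J ≠ ⊥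

/-- A dense left ideal `D` of `A`: for all `p ≠ 0` and `q` in `A` there is `c ∈ A` with
`c p ≠ 0` and `c q ∈ D`. -/
def IsDenseLeftIdeal (D : Submodule Φ A) : Prop :=
  (∀ a : A, ∀ d ∈ D, a * d ∈ D) ∧ ∀ p q : A, p ≠ 0 → ∃ c : A, c * p ≠ 0 ∧ c * q ∈ D

variable {Φ}

lemma IsIdeal.inf {I J : Submodule Φ A} (hI : IsIdeal Φ I) (hJ : IsIdeal Φ J) :
    IsIdeal Φ (I ⊓ J) := fun a b hb =>
  ⟨⟨(hI a b hb.1).1, (hJ a b hb.2).1⟩, ⟨(hI a b hb.1).2, (hJ a b hb.2).2⟩⟩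

lemma IsEssentialIdeal.inf {I J : Submodule Φ A} (hI : IsEssentialIdeal Φ I)
    (hJ : IsEssentialIdeal Φ J) : IsEssentialIdeal Φ (I ⊓ J) :=
  ⟨hI.1.inf hJ.1, fun K hK h0 => by
    rw [inf_assoc]
    exact hI.2 _ (hJ.1.inf hK) (hJ.2 K hK h0)⟩

lemma isEssentialIdeal_top : IsEssentialIdeal Φ (⊤ : Submodule Φ A) :=
  ⟨fun _ _ _ => ⟨trivial, trivial⟩, fun J _ h => by simpa using h⟩

lemma IsDenseLeftIdeal.inf {D E : Submodule Φ A} (hD : IsDenseLeftIdeal Φ D)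
    (hE : IsDenseLeftIdeal Φ E) : IsDenseLeftIdeal Φ (D ⊓ E) := by
  refine ⟨fun a d hd => ⟨hD.1 a d hd.1, hE.1 a d hd.2⟩, fun p q hp => ?_⟩
  obtain ⟨c, hc, hcq⟩ := hD.2 p q hp
  obtain ⟨b, hb, hbq⟩ := hE.2 (c * p) (c * q) hc
  exact ⟨b * c, by rwa [mul_assoc], by rw [mul_assoc]; exact ⟨hD.1 _ _ hcq, hbq⟩⟩

end Ideals

section Semiprime

variable (Φ : Type v) [CommRing Φ] {A : Type u} [NonUnitalRing A] [Module Φ A]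
  [IsScalarTower Φ A A] [SMulCommClass Φ A A]

lemma eq_zero_of_mul_left [IsSemiprimeAlgebra Φ A] {b : A} (h : ∀ a : A, a * b = 0) : b = 0 := by
  let L : Submodule Φ A :=
    { carrier := {b | ∀ a : A, a * b = 0}
      add_mem' := fun {x y} hx hy a => by rw [mul_add, hx a, hy a, add_zero]
      zero_mem' := fun a => mul_zero a
      smul_mem' := fun r x hx a => by rw [mul_smul_comm, hx a, smul_zero] }
  have hL : L = ⊥ := IsSemiprimeAlgebra.eq_bot_of_sq L
    (fun a b hb => ⟨fun c => by rw [← mul_assoc]; exact hb _,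
      fun c => by rw [← mul_assoc, hb c, zero_mul]⟩)
    (fun a _ b hb => hb a)
  have hb : b ∈ L := h
  rwa [hL, Submodule.mem_bot] at hb

lemma eq_zero_of_mul_right [IsSemiprimeAlgebra Φ A] {b : A} (h : ∀ a : A, b * a = 0) :
    b = 0 := by
  let L : Submodule Φ A :=
    { carrier := {b | ∀ a : A, b * a = 0}
      add_mem' := fun {x y} hx hy a => by rw [add_mul, hx a, hy a, add_zero]
      zero_mem' := fun a => zero_mul a
      smul_mem' := fun r x hx a => by rw [smul_mul_assoc, hx a, smul_zero] }
  have hL : L = ⊥ := IsSemiprimeAlgebra.eq_bot_of_sq L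
    (fun a b hb => ⟨fun c => by rw [mul_assoc, hb c, mul_zero],
      fun c => by rw [mul_assoc]; exact hb _⟩)
    (fun a ha b _ => ha b)
  have hb : b ∈ L := h
  rwa [hL, Submodule.mem_bot] at hb

lemma eq_zero_of_sandwich [IsSemiprimeAlgebra Φ A] {a : A} (h : ∀ b : A, a * b * a = 0) :
    a = 0 := by
  let I : Submodule Φ A := Submodule.span Φ {z | ∃ b c : A, z = b * a * c}
  have hI : I = ⊥ := by
    refine IsSemiprimeAlgebra.eq_bot_of_sq I ?_ ?_
    · intro d z hz
      induction hz using Submodule.span_induction with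
      | mem z hz =>
        obtain ⟨b, c, rfl⟩ := hz
        exact ⟨Submodule.subset_span ⟨d * b, c, by simp only [mul_assoc]⟩,
          Submodule.subset_span ⟨b, c * d, by simp only [mul_assoc]⟩⟩
      | zero => simp
      | add y z _ _ hy hz =>
        rw [mul_add, add_mul]
        exact ⟨I.add_mem hy.1 hz.1, I.add_mem hy.2 hz.2⟩
      | smul r z _ hz =>
        rw [mul_smul_comm, smul_mul_assoc]
        exact ⟨I.smul_mem r hz.1, I.smul_mem r hz.2⟩
    · intro y hy z hz
      induction hy using Submodule.span_induction with
      | mem y hy =>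
        obtain ⟨b, c, rfl⟩ := hy
        induction hz using Submodule.span_induction with
        | mem z hz =>
          obtain ⟨d, e, rfl⟩ := hz
          calc b * a * c * (d * a * e) = b * (a * (c * d) * a) * e := by simp only [mul_assoc]
            _ = 0 := by rw [h, mul_zero, zero_mul]
        | zero => simp
        | add y z _ _ hy hz => rw [mul_add, hy, hz, add_zero]
        | smul r z _ hz => rw [mul_smul_comm, hz, smul_zero]
      | zero => simp
      | add y z _ _ hy hz => rw [add_mul, hy, hz, add_zero]
      | smul r z _ hz => rw [smul_mul_assoc, hz, smul_zero]
  refine eq_zero_of_mul_left Φ fun b => eq_zero_of_mul_right Φ fun c => ?_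
  have : b * a * c ∈ I := Submodule.subset_span ⟨b, c, rfl⟩
  rwa [hI, Submodule.mem_bot] at this

lemma isSemiprimeAlgebra_of_sandwich (h : ∀ a : A, (∀ b : A, a * b * a = 0) → a = 0) :
    IsSemiprimeAlgebra Φ A where
  eq_bot_of_sq I hI hsq := by
    rw [Submodule.eq_bot_iff]
    intro a ha
    exact h a fun b => hsq _ ((hI b a ha).2) _ ha

lemma isDenseLeftIdeal_top [IsSemiprimeAlgebra Φ A] :
    IsDenseLeftIdeal Φ (⊤ : Submodule Φ A) := by
  refine ⟨fun _ _ _ => trivial, fun p q hp => ?_⟩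
  by_contra! hc
  exact hp (eq_zero_of_mul_left Φ fun a => by_contra fun h => hc a h trivial)

end Semiprime

/-! ## The maximal left quotient algebra -/

section QMax

variable (Φ : Type v) [CommRing Φ] (A : Type u) [NonUnitalRing A] [Module Φ A]

/-- A homomorphism of left `A`-modules `D → A` on a dense left ideal `D` of `A`. It is stored as a
function on `A`, of which only the values on `D` matter: representatives are compared, in
`PartialHom.setoid`, through their values on `D` alone. -/
structure PartialHom where
  dom : Submodule Φ A
  dense : IsDenseLeftIdeal Φ dom
  toFun : A → A
  map_add : ∀ d ∈ dom, ∀ e ∈ dom, toFun (d + e) = toFun d + toFun e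
  map_smul : ∀ r : Φ, ∀ d ∈ dom, toFun (r • d) = r • toFun d
  map_mul : ∀ a : A, ∀ d ∈ dom, toFun (a * d) = a * toFun d

/-- Two partial homomorphisms are identified when they agree on a dense left ideal on which both
are defined. -/
instance PartialHom.setoid : Setoid (PartialHom Φ A) where
  r f g := ∃ D : Submodule Φ A, IsDenseLeftIdeal Φ D ∧ D ≤ f.dom ∧ D ≤ g.dom ∧
    ∀ d ∈ D, f.toFun d = g.toFun d
  iseqv :=
    { refl := fun f => ⟨f.dom, f.dense, le_rfl, le_rfl, fun _ _ => rfl⟩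
      symm := fun ⟨D, h, h1, h2, h3⟩ => ⟨D, h, h2, h1, fun d hd => (h3 d hd).symm⟩
      trans := fun ⟨D, h, h1, _, h3⟩ ⟨E, k, _, k2, k3⟩ =>
        ⟨D ⊓ E, h.inf k, inf_le_left.trans h1, inf_le_right.trans k2,
          fun d hd => (h3 d hd.1).trans (k3 d hd.2)⟩ }

/-- The maximal left quotient algebra `Q^l_max(A)`: classes `[D, f]` of left `A`-module
homomorphisms `f : D → A` on dense left ideals `D`. -/
def QMax : Type u := Quotient (PartialHom.setoid Φ A)

variable {Φ A}

lemma PartialHom.map_zero (f : PartialHom Φ A) : f.toFun 0 = 0 := by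
  simpa using f.map_smul 0 0 f.dom.zero_mem

/-- The sum of `f` and `g`, defined on the intersection of the domains. -/
def PartialHom.add (f g : PartialHom Φ A) : PartialHom Φ A where
  dom := f.dom ⊓ g.dom
  dense := f.dense.inf g.dense
  toFun d := f.toFun d + g.toFun d
  map_add d hd e he := by
    rw [f.map_add d hd.1 e he.1, g.map_add d hd.2 e he.2]; abel
  map_smul r d hd := by rw [f.map_smul r d hd.1, g.map_smul r d hd.2, smul_add]
  map_mul a d hd := by rw [f.map_mul a d hd.1, g.map_mul a d hd.2, mul_add]

/-- The opposite of `f`. -/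
def PartialHom.neg (f : PartialHom Φ A) : PartialHom Φ A where
  dom := f.dom
  dense := f.dense
  toFun d := -f.toFun d
  map_add d hd e he := by rw [f.map_add d hd e he, neg_add]
  map_smul r d hd := by rw [f.map_smul r d hd, smul_neg]
  map_mul a d hd := by rw [f.map_mul a d hd, mul_neg]

/-- The product of `f` and `g`: first apply `f`, then `g`, as for homomorphisms written on the
right of their arguments, `(d)(fg) = ((d)f)g`. It is defined on `{d ∈ dom f | (d)f ∈ dom g}`. -/
def PartialHom.mul (f g : PartialHom Φ A) : PartialHom Φ A where
  dom :=
    { carrier := {d | d ∈ f.dom ∧ f.toFun d ∈ g.dom}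
      add_mem' := fun {d e} hd he => ⟨f.dom.add_mem hd.1 he.1, by
        rw [f.map_add d hd.1 e he.1]; exact g.dom.add_mem hd.2 he.2⟩
      zero_mem' := ⟨f.dom.zero_mem, by rw [f.map_zero]; exact g.dom.zero_mem⟩
      smul_mem' := fun r d hd => ⟨f.dom.smul_mem r hd.1, by
        rw [f.map_smul r d hd.1]; exact g.dom.smul_mem r hd.2⟩ }
  dense := by
    refine ⟨fun a d hd => ⟨f.dense.1 a d hd.1, ?_⟩, fun p q hp => ?_⟩
    · rw [f.map_mul a d hd.1]; exact g.dense.1 _ _ hd.2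
    · obtain ⟨a, ha, haq⟩ := f.dense.2 p q hp
      obtain ⟨b, hb, hbq⟩ := g.dense.2 (a * p) (f.toFun (a * q)) ha
      refine ⟨b * a, by rwa [mul_assoc], ?_⟩
      rw [mul_assoc]
      exact ⟨f.dense.1 _ _ haq, by rw [f.map_mul b _ haq]; exact hbq⟩
  toFun d := g.toFun (f.toFun d)
  map_add d hd e he := by
    rw [f.map_add d hd.1 e he.1, g.map_add _ hd.2 _ he.2]
  map_smul r d hd := by rw [f.map_smul r d hd.1, g.map_smul r _ hd.2]
  map_mul a d hd := by rw [f.map_mul a d hd.1, g.map_mul a _ hd.2]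

lemma PartialHom.equiv_of_eqOn {f g : PartialHom Φ A}
    (h : ∀ d ∈ f.dom ⊓ g.dom, f.toFun d = g.toFun d) :
    (Quotient.mk _ f : QMax Φ A) = Quotient.mk _ g :=
  Quotient.sound ⟨f.dom ⊓ g.dom, f.dense.inf g.dense, inf_le_left, inf_le_right, h⟩

instance : Add (QMax Φ A) where
  add := Quotient.map₂ PartialHom.add (by
    rintro f f' ⟨D, h, h1, h2, h3⟩ g g' ⟨E, k, k1, k2, k3⟩
    exact ⟨D ⊓ E, h.inf k, inf_le_inf h1 k1, inf_le_inf h2 k2, fun d hd =>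
      congrArg₂ (· + ·) (h3 d hd.1) (k3 d hd.2)⟩)

instance : Neg (QMax Φ A) where
  neg := Quotient.map PartialHom.neg (by
    rintro f f' ⟨D, h, h1, h2, h3⟩
    exact ⟨D, h, h1, h2, fun d hd => congrArg Neg.neg (h3 d hd)⟩)

instance : Mul (QMax Φ A) where
  mul := Quotient.map₂ PartialHom.mul (by
    rintro f f' ⟨D, h, h1, h2, h3⟩ g g' ⟨E, k, k1, k2, k3⟩
    let fD : PartialHom Φ A := ⟨D, h, f.toFun, fun d hd e he => f.map_add d (h1 hd) e (h1 he),
      fun r d hd => f.map_smul r d (h1 hd), fun a d hd => f.map_mul a d (h1 hd)⟩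
    let gE : PartialHom Φ A := ⟨E, k, g.toFun, fun d hd e he => g.map_add d (k1 hd) e (k1 he),
      fun r d hd => g.map_smul r d (k1 hd), fun a d hd => g.map_mul a d (k1 hd)⟩
    refine ⟨(fD.mul gE).dom, (fD.mul gE).dense, fun d hd => ⟨h1 hd.1, k1 hd.2⟩,
      fun d hd => ⟨h2 hd.1, ?_⟩, fun d hd => ?_⟩
    · rw [← h3 d hd.1]; exact k2 hd.2
    · change g.toFun (f.toFun d) = g'.toFun (f'.toFun d)
      rw [← h3 d hd.1]; exact k3 _ hd.2)

section Scalars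

variable [IsScalarTower Φ A A] [SMulCommClass Φ A A]

/-- Scalar multiple of `f`. -/
def PartialHom.smul (r : Φ) (f : PartialHom Φ A) : PartialHom Φ A where
  dom := f.dom
  dense := f.dense
  toFun d := r • f.toFun d
  map_add d hd e he := by rw [f.map_add d hd e he, smul_add]
  map_smul s d hd := by rw [f.map_smul s d hd, smul_comm]
  map_mul a d hd := by rw [f.map_mul a d hd, mul_smul_comm]

instance : SMul Φ (QMax Φ A) where
  smul r := Quotient.map (PartialHom.smul r) (by
    rintro f f' ⟨D, h, h1, h2, h3⟩
    exact ⟨D, h, h1, h2, fun d hd => congrArg (r • ·) (h3 d hd)⟩)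

variable [IsSemiprimeAlgebra Φ A]

/-- The zero map `A → A`. -/
def PartialHom.zero : PartialHom Φ A :=
  ⟨⊤, isDenseLeftIdeal_top Φ, fun _ => 0, by simp, by simp, by simp⟩

/-- The identity map `A → A`. -/
def PartialHom.one : PartialHom Φ A :=
  ⟨⊤, isDenseLeftIdeal_top Φ, fun d => d, by simp, by simp, by simp⟩

/-- Right multiplication `ρ_a : A → A`, `d ↦ d a`. -/
def PartialHom.rightMul (a : A) : PartialHom Φ A :=
  ⟨⊤, isDenseLeftIdeal_top Φ, fun d => d * a, fun d _ e _ => add_mul d e a,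
    fun r d _ => smul_mul_assoc r d a, fun b d _ => mul_assoc b d a⟩

instance : Zero (QMax Φ A) := ⟨Quotient.mk _ PartialHom.zero⟩

instance : One (QMax Φ A) := ⟨Quotient.mk _ PartialHom.one⟩

instance : Ring (QMax Φ A) where
  add_assoc := by
    rintro ⟨f⟩ ⟨g⟩ ⟨h⟩
    exact PartialHom.equiv_of_eqOn fun d _ => add_assoc _ _ _
  zero_add := by
    rintro ⟨f⟩
    exact PartialHom.equiv_of_eqOn fun d _ => zero_add _
  add_zero := by
    rintro ⟨f⟩
    exact PartialHom.equiv_of_eqOn fun d _ => add_zero _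
  add_comm := by
    rintro ⟨f⟩ ⟨g⟩
    exact PartialHom.equiv_of_eqOn fun d _ => add_comm _ _
  neg_add_cancel := by
    rintro ⟨f⟩
    exact PartialHom.equiv_of_eqOn fun d _ => neg_add_cancel _
  mul_assoc := by
    rintro ⟨f⟩ ⟨g⟩ ⟨h⟩
    exact PartialHom.equiv_of_eqOn fun d _ => rfl
  one_mul := by
    rintro ⟨f⟩
    exact PartialHom.equiv_of_eqOn fun d _ => rfl
  mul_one := by
    rintro ⟨f⟩
    exact PartialHom.equiv_of_eqOn fun d _ => rfl
  zero_mul := by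
    rintro ⟨f⟩
    exact PartialHom.equiv_of_eqOn fun d _ => f.map_zero
  mul_zero := by
    rintro ⟨f⟩
    exact PartialHom.equiv_of_eqOn fun d _ => rfl
  left_distrib := by
    rintro ⟨f⟩ ⟨g⟩ ⟨h⟩
    exact PartialHom.equiv_of_eqOn fun d _ => rfl
  right_distrib := by
    rintro ⟨f⟩ ⟨g⟩ ⟨h⟩
    exact PartialHom.equiv_of_eqOn fun d hd => h.map_add _ hd.2.1.2 _ hd.2.2.2
  nsmul := nsmulRec
  zsmul := zsmulRec

instance : Module Φ (QMax Φ A) where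
  one_smul := by
    rintro ⟨f⟩
    exact PartialHom.equiv_of_eqOn fun d _ => one_smul _ _
  mul_smul := by
    rintro r s ⟨f⟩
    exact PartialHom.equiv_of_eqOn fun d _ => mul_smul _ _ _
  smul_zero := fun r => PartialHom.equiv_of_eqOn fun d _ => smul_zero _
  smul_add := by
    rintro r ⟨f⟩ ⟨g⟩
    exact PartialHom.equiv_of_eqOn fun d _ => smul_add _ _ _
  add_smul := by
    rintro r s ⟨f⟩
    exact PartialHom.equiv_of_eqOn fun d _ => add_smul _ _ _
  zero_smul := by
    rintro ⟨f⟩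
    exact PartialHom.equiv_of_eqOn fun d _ => zero_smul _ _

instance : Algebra Φ (QMax Φ A) := Algebra.ofModule
  (by
    rintro r ⟨f⟩ ⟨g⟩
    exact PartialHom.equiv_of_eqOn fun d hd => g.map_smul _ _ hd.2.2)
  (by
    rintro r ⟨f⟩ ⟨g⟩
    exact PartialHom.equiv_of_eqOn fun d _ => rfl)

variable (Φ A) in
/-- The embedding `A → Q^l_max(A)`, `a ↦ [A, ρ_a]`. -/
def QMax.of : A →ₙₐ[Φ] QMax Φ A where
  toFun a := Quotient.mk _ (PartialHom.rightMul a)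
  map_smul' r a := PartialHom.equiv_of_eqOn fun d _ => mul_smul_comm r d a
  map_zero' := PartialHom.equiv_of_eqOn fun d _ => mul_zero d
  map_add' a b := PartialHom.equiv_of_eqOn fun d _ => mul_add d a b
  map_mul' a b := PartialHom.equiv_of_eqOn fun d _ => (mul_assoc d a b).symm

lemma QMax.of_injective : Function.Injective (QMax.of Φ A) := by
  intro a b hab
  obtain ⟨D, hD, -, -, h⟩ := Quotient.exact hab
  by_contra hne
  obtain ⟨c, hc, -⟩ := hD.2 (a - b) 0 (sub_ne_zero.2 hne)
  obtain ⟨e, he, heD⟩ := hD.2 (c * (a - b)) c hc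
  have h1 : (e * c) * a = (e * c) * b := h _ heD
  exact he (by rw [← mul_assoc, mul_sub, h1, sub_self])

end Scalars

end QMax

/-! ## The Martindale symmetric algebra of quotients -/

section QS

variable (Φ : Type v) [CommRing Φ] (A : Type u) [NonUnitalRing A] [Module Φ A]
  [IsScalarTower Φ A A] [SMulCommClass Φ A A]

/-- The span of the products of two elements of `I`. -/
def sqIdeal {A : Type u} [NonUnitalRing A] [Module Φ A] (I : Submodule Φ A) : Submodule Φ A :=
  Submodule.span Φ {z | ∃ a ∈ I, ∃ b ∈ I, z = a * b}

variable {Φ A} in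
lemma IsEssentialIdeal.sq [IsSemiprimeAlgebra Φ A] {I : Submodule Φ A}
    (hI : IsEssentialIdeal Φ I) : IsEssentialIdeal Φ (sqIdeal Φ I) := by
  refine ⟨fun a z hz => ?_, fun J hJ h0 hbot => ?_⟩
  · induction hz using Submodule.span_induction with
    | mem z hz =>
      obtain ⟨b, hb, c, hc, rfl⟩ := hz
      exact ⟨Submodule.subset_span ⟨a * b, (hI.1 a b hb).1, c, hc, by rw [mul_assoc]⟩,
        Submodule.subset_span ⟨b, hb, c * a, (hI.1 a c hc).2, by rw [mul_assoc]⟩⟩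
    | zero => simp
    | add y z _ _ hy hz =>
      rw [mul_add, add_mul]
      exact ⟨Submodule.add_mem _ hy.1 hz.1, Submodule.add_mem _ hy.2 hz.2⟩
    | smul r z _ hz =>
      rw [mul_smul_comm, smul_mul_assoc]
      exact ⟨Submodule.smul_mem _ r hz.1, Submodule.smul_mem _ r hz.2⟩
  · refine hI.2 J hJ h0 (IsSemiprimeAlgebra.eq_bot_of_sq _ (hI.1.inf hJ) fun a ha b hb => ?_)
    have : a * b ∈ sqIdeal Φ I ⊓ J :=
      ⟨Submodule.subset_span ⟨a, ha.1, b, hb.1, rfl⟩, (hJ a b hb.2).1⟩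
    rwa [hbot, Submodule.mem_bot] at this

variable [IsSemiprimeAlgebra Φ A]

/-- The Martindale symmetric algebra of quotients `Q_s(A)` of a semiprime algebra `A`: the
elements `q` of `Q^l_max(A)` for which there is an essential ideal `I` of `A` with
`I q + q I ⊆ A`. -/
def QsSubalgebra : Subalgebra Φ (QMax Φ A) where
  carrier := {q | ∃ I : Submodule Φ A, IsEssentialIdeal Φ I ∧ ∀ a ∈ I,
    QMax.of Φ A a * q ∈ Set.range (QMax.of Φ A) ∧ q * QMax.of Φ A a ∈ Set.range (QMax.of Φ A)}
  algebraMap_mem' r := ⟨⊤, isEssentialIdeal_top, fun a _ =>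
    ⟨⟨r • a, by rw [map_smul, ← Algebra.commutes, Algebra.smul_def]⟩,
      ⟨r • a, by rw [map_smul, Algebra.smul_def]⟩⟩⟩
  add_mem' := by
    rintro p q ⟨I, hI, h⟩ ⟨J, hJ, k⟩
    refine ⟨I ⊓ J, hI.inf hJ, fun a ha => ?_⟩
    obtain ⟨⟨b, hb⟩, ⟨c, hc⟩⟩ := h a ha.1
    obtain ⟨⟨b', hb'⟩, ⟨c', hc'⟩⟩ := k a ha.2
    exact ⟨⟨b + b', by rw [map_add, hb, hb', mul_add]⟩, ⟨c + c', by rw [map_add, hc, hc', add_mul]⟩⟩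
  mul_mem' := by
    rintro p q ⟨I, hI, h⟩ ⟨J, hJ, k⟩
    refine ⟨sqIdeal Φ (I ⊓ J), (hI.inf hJ).sq, fun z hz => ?_⟩
    induction hz using Submodule.span_induction with
    | mem z hz =>
      obtain ⟨a, ha, b, hb, rfl⟩ := hz
      obtain ⟨b', hb'⟩ := (h b hb.1).1
      obtain ⟨c, hc⟩ := (k (a * b') (hJ.1 b' a ha.2).2).1
      obtain ⟨a', ha'⟩ := (k a ha.2).2
      obtain ⟨d, hd⟩ := (h (a' * b) (hI.1 a' b hb.1).1).2
      refine ⟨⟨c, ?_⟩, ⟨d, ?_⟩⟩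
      · rw [hc, map_mul, map_mul, hb']; simp only [mul_assoc]
      · rw [hd, map_mul, map_mul, ha']; simp only [mul_assoc]
    | zero => exact ⟨⟨0, by simp⟩, ⟨0, by simp⟩⟩
    | add y z _ _ hy hz =>
      obtain ⟨⟨b, hb⟩, ⟨c, hc⟩⟩ := hy
      obtain ⟨⟨b', hb'⟩, ⟨c', hc'⟩⟩ := hz
      exact ⟨⟨b + b', by rw [map_add, hb, hb', map_add, add_mul]⟩,
        ⟨c + c', by rw [map_add, hc, hc', map_add, mul_add]⟩⟩
    | smul r z _ hz =>
      obtain ⟨⟨b, hb⟩, ⟨c, hc⟩⟩ := hz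
      exact ⟨⟨r • b, by rw [map_smul, hb, map_smul, smul_mul_assoc]⟩,
        ⟨r • c, by rw [map_smul, hc, map_smul, mul_smul_comm]⟩⟩

/-- `Q_s(A)` as a (unital) `Φ`-algebra. -/
abbrev Qs : Type u := QsSubalgebra Φ A

/-- The canonical embedding `A → Q_s(A)`. -/
def Qs.of : A →ₙₐ[Φ] Qs Φ A where
  toFun a := ⟨QMax.of Φ A a, ⊤, isEssentialIdeal_top, fun b _ =>
    ⟨⟨b * a, map_mul _ b a⟩, ⟨a * b, map_mul _ a b⟩⟩⟩
  map_smul' r a := Subtype.ext (map_smul (QMax.of Φ A) r a)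
  map_zero' := Subtype.ext (map_zero (QMax.of Φ A))
  map_add' a b := Subtype.ext (map_add (QMax.of Φ A) a b)
  map_mul' a b := Subtype.ext (map_mul (QMax.of Φ A) a b)

lemma Qs.of_injective : Function.Injective (Qs.of Φ A) := fun _ _ h =>
  QMax.of_injective (congrArg Subtype.val h)

/-- The copy of `A` inside `Q_s(A)`. -/
def Qs.base : NonUnitalSubalgebra Φ (Qs Φ A) := NonUnitalAlgHom.range (Qs.of Φ A)

instance Qs.base_isSemiprime : IsSemiprimeAlgebra Φ (Qs.base Φ A) := by
  refine isSemiprimeAlgebra_of_sandwich Φ ?_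
  rintro ⟨_, a, rfl⟩ h
  have ha : a = 0 := eq_zero_of_sandwich Φ fun b => by
    have hb := congrArg Subtype.val (h ⟨Qs.of Φ A b, b, rfl⟩)
    apply Qs.of_injective Φ A
    rw [map_mul, map_mul, map_zero]
    exact hb
  subst ha
  exact Subtype.ext (map_zero (Qs.of Φ A))

end QS

/-! ## Local algebras and corners -/

section Local

variable {Φ : Type v} [CommRing Φ] {Q : Type u} [Ring Q] [Algebra Φ Q]

/-- `x S + S x ⊆ S`. -/
def Absorbs (S : NonUnitalSubalgebra Φ Q) (x : Q) : Prop :=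
  ∀ s ∈ S, x * s ∈ S ∧ s * x ∈ S

lemma absorbs_top (x : Q) : Absorbs (⊤ : NonUnitalSubalgebra Φ Q) x :=
  fun _ _ => ⟨trivial, trivial⟩

/-- The submodule `x S x`. -/
def sandwich (S : NonUnitalSubalgebra Φ Q) (x : Q) : Submodule Φ Q where
  carrier := {y | ∃ s ∈ S, y = x * s * x}
  add_mem' := by
    rintro _ _ ⟨s, hs, rfl⟩ ⟨t, ht, rfl⟩
    exact ⟨s + t, add_mem hs ht, by rw [mul_add, add_mul]⟩
  zero_mem' := ⟨0, zero_mem S, by simp⟩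
  smul_mem' := by
    rintro r _ ⟨s, hs, rfl⟩
    exact ⟨r • s, SMulMemClass.smul_mem r hs, by simp⟩

/-- The local algebra `S_x` of `S` at `x`: the module `x S x` with the product
`xsx · xtx = xsxtx` (see `LocalAlgebra.mk_mul_mk`). -/
def LocalAlgebra (S : NonUnitalSubalgebra Φ Q) (x : Q) (_hx : Absorbs S x) : Type u :=
  sandwich S x

namespace LocalAlgebra

variable {S : NonUnitalSubalgebra Φ Q} {x : Q} {hx : Absorbs S x}

instance : AddCommGroup (LocalAlgebra S x hx) := inferInstanceAs (AddCommGroup (sandwich S x))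

instance : Module Φ (LocalAlgebra S x hx) := inferInstanceAs (Module Φ (sandwich S x))

/-- The inclusion of `S_x = x S x` in `Q`. -/
def val : LocalAlgebra S x hx →ₗ[Φ] Q := (sandwich S x).subtype

lemma val_injective : Function.Injective (val : LocalAlgebra S x hx → Q) :=
  Subtype.val_injective

variable (hx) in
/-- The element `x s x` of `S_x`. -/
def mk (s : Q) (hs : s ∈ S) : LocalAlgebra S x hx := ⟨x * s * x, s, hs, rfl⟩

@[simp] lemma val_mk (s : Q) (hs : s ∈ S) : val (mk hx s hs) = x * s * x := rfl

lemma exists_mk (y : LocalAlgebra S x hx) : ∃ (s : Q) (hs : s ∈ S), y = mk hx s hs := by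
  obtain ⟨_, s, hs, rfl⟩ := y
  exact ⟨s, hs, rfl⟩

/-- An element `s` of `S` with `y = x s x`. -/
def core (y : LocalAlgebra S x hx) : Q := (exists_mk y).choose

lemma core_mem (y : LocalAlgebra S x hx) : core y ∈ S := (exists_mk y).choose_spec.choose

lemma core_spec (y : LocalAlgebra S x hx) : x * core y * x = val y :=
  (congrArg val (exists_mk y).choose_spec.choose_spec).symm

instance : Mul (LocalAlgebra S x hx) where
  mul y z := mk hx (core y * x * core z) (mul_mem (hx _ (core_mem y)).2 (core_mem z))

lemma val_mul_core (y z : LocalAlgebra S x hx) :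
    val (y * z) = x * (core y * x * core z) * x := rfl

lemma val_mul_left (y : LocalAlgebra S x hx) (t : Q) (ht : t ∈ S) :
    val (y * mk hx t ht) = val y * t * x := by
  have h := core_spec (mk hx t ht)
  rw [val_mk] at h
  rw [val_mul_core, ← core_spec y]
  calc x * (core y * x * core (mk hx t ht)) * x
      = x * core y * (x * core (mk hx t ht) * x) := by simp only [mul_assoc]
    _ = x * core y * x * t * x := by rw [h]; simp only [mul_assoc]

/-- The defining product `xsx · xtx = xsxtx`. -/
lemma mk_mul_mk (s t : Q) (hs : s ∈ S) (ht : t ∈ S) :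
    mk hx s hs * mk hx t ht = mk hx (s * x * t) (mul_mem (hx s hs).2 ht) := by
  apply val_injective
  rw [val_mul_left, val_mk, val_mk]
  simp only [mul_assoc]

instance : NonUnitalRing (LocalAlgebra S x hx) where
  left_distrib a b c := by
    obtain ⟨s, hs, rfl⟩ := exists_mk b
    obtain ⟨t, ht, rfl⟩ := exists_mk c
    have h : mk hx s hs + mk hx t ht = mk hx (s + t) (add_mem hs ht) :=
      val_injective (by simp [mul_add, add_mul])
    apply val_injective
    rw [h, map_add]
    simp only [val_mul_left, mul_add, add_mul]
  right_distrib a b c := by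
    obtain ⟨t, ht, rfl⟩ := exists_mk c
    apply val_injective
    rw [map_add]
    simp only [val_mul_left, map_add, add_mul]
  zero_mul a := by
    obtain ⟨t, ht, rfl⟩ := exists_mk a
    apply val_injective
    simp only [val_mul_left, map_zero, zero_mul]
  mul_zero a := by
    have h : (0 : LocalAlgebra S x hx) = mk hx 0 (zero_mem S) := val_injective (by simp)
    apply val_injective
    rw [h, val_mul_left]
    simp
  mul_assoc a b c := by
    obtain ⟨r, hr, rfl⟩ := exists_mk a
    obtain ⟨s, hs, rfl⟩ := exists_mk b
    obtain ⟨t, ht, rfl⟩ := exists_mk c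
    apply val_injective
    rw [mk_mul_mk s t, val_mul_left, val_mul_left, val_mul_left]
    simp only [mul_assoc]

instance : IsScalarTower Φ (LocalAlgebra S x hx) (LocalAlgebra S x hx) where
  smul_assoc r a b := by
    obtain ⟨t, ht, rfl⟩ := exists_mk b
    apply val_injective
    simp only [smul_eq_mul, val_mul_left, map_smul, smul_mul_assoc]

instance : SMulCommClass Φ (LocalAlgebra S x hx) (LocalAlgebra S x hx) where
  smul_comm r a b := by
    obtain ⟨t, ht, rfl⟩ := exists_mk b
    have h : r • mk hx t ht = mk hx (r • t) (SMulMemClass.smul_mem r ht) := val_injective (by simp)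
    apply val_injective
    rw [h]
    simp only [smul_eq_mul, val_mul_left, map_smul, smul_mul_assoc, mul_smul_comm]

/-- A local algebra of a semiprime algebra is semiprime. -/
instance [IsSemiprimeAlgebra Φ S] : IsSemiprimeAlgebra Φ (LocalAlgebra S x hx) := by
  refine isSemiprimeAlgebra_of_sandwich Φ fun a h => ?_
  obtain ⟨s, hs, rfl⟩ := exists_mk a
  have hmem : x * s * x ∈ S := (hx _ (hx s hs).1).2
  have h0 : (⟨x * s * x, hmem⟩ : S) = 0 := eq_zero_of_sandwich Φ fun b => by
    have hb := congrArg val (h (mk hx b.1 b.2))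
    rw [mk_mul_mk, mk_mul_mk, val_mk, map_zero] at hb
    apply Subtype.ext
    change x * s * x * b.1 * (x * s * x) = 0
    rw [← hb]
    simp only [mul_assoc]
  have h1 : x * s * x = 0 := congrArg Subtype.val h0
  exact val_injective h1

end LocalAlgebra

/-- The corner `e S e` of `S` at an idempotent `e`, a subalgebra of `Q`. -/
def corner (S : NonUnitalSubalgebra Φ Q) (e : Q) (_hid : IsIdempotentElem e)
    (he : Absorbs S e) : NonUnitalSubalgebra Φ Q where
  carrier := {y | ∃ s ∈ S, y = e * s * e}
  add_mem' := (sandwich S e).add_mem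
  zero_mem' := (sandwich S e).zero_mem
  smul_mem' := fun r _ h => (sandwich S e).smul_mem r h
  mul_mem' := by
    rintro _ _ ⟨s, hs, rfl⟩ ⟨t, ht, rfl⟩
    exact ⟨(s * e) * (e * t), mul_mem (he s hs).2 (he t ht).1, by simp only [mul_assoc]⟩

/-- A corner `e S e` of a semiprime algebra is semiprime. -/
instance {S : NonUnitalSubalgebra Φ Q} {e : Q} {hid : IsIdempotentElem e} {he : Absorbs S e}
    [IsSemiprimeAlgebra Φ S] : IsSemiprimeAlgebra Φ (corner S e hid he) := by
  have hee : e * e = e := hid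
  refine isSemiprimeAlgebra_of_sandwich Φ ?_
  rintro ⟨_, s, hs, rfl⟩ h
  have hmem : e * s * e ∈ S := (he _ (he s hs).1).2
  have h0 : (⟨e * s * e, hmem⟩ : S) = 0 := eq_zero_of_sandwich Φ fun b => by
    have hb : e * s * e * (e * b.1 * e) * (e * s * e) = 0 :=
      congrArg Subtype.val (h ⟨e * b.1 * e, b.1, b.2, rfl⟩)
    apply Subtype.ext
    change e * s * e * b.1 * (e * s * e) = 0
    rw [← hb]
    calc e * s * e * b.1 * (e * s * e) = e * s * (e * e) * b.1 * ((e * e) * s * e) := by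
          rw [hee]
      _ = e * s * e * (e * b.1 * e) * (e * s * e) := by simp only [mul_assoc]
  have h1 : e * s * e = 0 := congrArg Subtype.val h0
  exact Subtype.ext h1

end Local

/-- An element `x` is von Neumann regular if `x = x y x` for some `y`. -/
def IsVonNeumannRegular {Q : Type u} [Mul Q] (x : Q) : Prop := ∃ y : Q, x = x * y * x

end Martindale

end

noncomputable section

namespace Martindale

universe u v w

section Essential

variable {Φ : Type v} [CommRing Φ] {A : Type u} [NonUnitalRing A] [Module Φ A]
  [IsScalarTower Φ A A] [SMulCommClass Φ A A]

lemma IsEssentialIdeal.eq_zero_of_mul_left [IsSemiprimeAlgebra Φ A] {I : Submodule Φ A}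
    (hI : IsEssentialIdeal Φ I) {p : A} (hp : ∀ a ∈ I, a * p = 0) : p = 0 := by
  let J : Submodule Φ A :=
    { carrier := {p | ∀ a ∈ I, a * p = 0}
      add_mem' := fun {x y} hx hy a ha => by rw [mul_add, hx a ha, hy a ha, add_zero]
      zero_mem' := fun a _ => mul_zero a
      smul_mem' := fun r x hx a ha => by rw [mul_smul_comm, hx a ha, smul_zero] }
  have hJ : IsIdeal Φ J := fun c b hb =>
    ⟨fun a ha => by rw [← mul_assoc]; exact hb _ (hI.1 c a ha).2,
      fun a ha => by rw [← mul_assoc, hb a ha, zero_mul]⟩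
  have hbot : I ⊓ J = ⊥ :=
    IsSemiprimeAlgebra.eq_bot_of_sq _ (hI.1.inf hJ) fun a ha b hb => hb.2 a ha.1
  by_contra h0
  exact hI.2 J hJ (fun h => h0 (by
    have : p ∈ J := hp
    rwa [h, Submodule.mem_bot] at this)) hbot

lemma IsEssentialIdeal.eq_zero_of_mul_right [IsSemiprimeAlgebra Φ A] {I : Submodule Φ A}
    (hI : IsEssentialIdeal Φ I) {p : A} (hp : ∀ a ∈ I, p * a = 0) : p = 0 := by
  let J : Submodule Φ A :=
    { carrier := {p | ∀ a ∈ I, p * a = 0}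
      add_mem' := fun {x y} hx hy a ha => by rw [add_mul, hx a ha, hy a ha, add_zero]
      zero_mem' := fun a _ => zero_mul a
      smul_mem' := fun r x hx a ha => by rw [smul_mul_assoc, hx a ha, smul_zero] }
  have hJ : IsIdeal Φ J := fun c b hb =>
    ⟨fun a ha => by rw [mul_assoc, hb a ha, mul_zero],
      fun a ha => by rw [mul_assoc]; exact hb _ (hI.1 c a ha).1⟩
  have hbot : I ⊓ J = ⊥ :=
    IsSemiprimeAlgebra.eq_bot_of_sq _ (hI.1.inf hJ) fun a ha b hb => ha.2 b hb.1
  by_contra h0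
  exact hI.2 J hJ (fun h => h0 (by
    have : p ∈ J := hp
    rwa [h, Submodule.mem_bot] at this)) hbot

lemma IsIdeal.isEssentialIdeal {I : Submodule Φ A} (hI : IsIdeal Φ I)
    (h : ∀ p : A, (∀ a ∈ I, p * a = 0) → p = 0) : IsEssentialIdeal Φ I := by
  refine ⟨hI, fun J hJ h0 hbot => h0 ((Submodule.eq_bot_iff _).2 fun p hp => h p fun a ha => ?_)⟩
  have : p * a ∈ I ⊓ J := ⟨(hI p a ha).1, (hJ a p hp).2⟩
  rwa [hbot, Submodule.mem_bot] at this

lemma IsEssentialIdeal.isDenseLeftIdeal [IsSemiprimeAlgebra Φ A] {I : Submodule Φ A}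
    (hI : IsEssentialIdeal Φ I) : IsDenseLeftIdeal Φ I := by
  refine ⟨fun a d hd => (hI.1 a d hd).1, fun p q hp => ?_⟩
  by_contra! h
  exact hp (hI.eq_zero_of_mul_left fun a ha => by_contra fun h0 => h a h0 (hI.1 q a ha).2)

end Essential

/-! ## Abstract symmetric algebras of quotients -/

/-- The homomorphism `ι : B → T` makes `T` a Martindale symmetric algebra of quotients of `B`. -/
structure IsSymmetricQuotient {Φ : Type v} [CommRing Φ] {B : Type u} [NonUnitalRing B]
    [Module Φ B] {T : Type w} [NonUnitalRing T] [Module Φ T] (ι : B →ₙₐ[Φ] T) : Prop where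
  injective : Function.Injective ι
  exists_ideal : ∀ q : T, ∃ I : Submodule Φ B, IsEssentialIdeal Φ I ∧
    ∀ a ∈ I, (∃ b, ι a * q = ι b) ∧ ∃ b, q * ι a = ι b
  eq_zero_of_left : ∀ (q : T) (I : Submodule Φ B), IsEssentialIdeal Φ I →
    (∀ a ∈ I, ι a * q = 0) → q = 0
  eq_zero_of_right : ∀ (q : T) (I : Submodule Φ B), IsEssentialIdeal Φ I →
    (∀ a ∈ I, q * ι a = 0) → q = 0
  exists_of_compatible : ∀ (I : Submodule Φ B), IsEssentialIdeal Φ I → ∀ f g : B → B,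
    (∀ a ∈ I, ∀ b ∈ I, f a * b = a * g b) →
      ∃ q : T, ∀ a ∈ I, ι a * q = ι (f a) ∧ q * ι a = ι (g a)

section QMax

variable {Φ : Type v} [CommRing Φ] {A : Type u} [NonUnitalRing A] [Module Φ A]
  [IsScalarTower Φ A A] [SMulCommClass Φ A A] [IsSemiprimeAlgebra Φ A]

/-- The class of a partial homomorphism. -/
def QMax.mk (f : PartialHom Φ A) : QMax Φ A := Quotient.mk _ f

lemma QMax.of_mul_mk (f : PartialHom Φ A) {d : A} (hd : d ∈ f.dom) :
    QMax.of Φ A d * QMax.mk f = QMax.of Φ A (f.toFun d) :=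
  PartialHom.equiv_of_eqOn fun b _ => f.map_mul b d hd

lemma QMax.mk_eq_zero (f : PartialHom Φ A) {D : Submodule Φ A} (hD : IsDenseLeftIdeal Φ D)
    (h : ∀ d ∈ D ⊓ f.dom, f.toFun d = 0) : QMax.mk f = 0 :=
  Quotient.sound ⟨D ⊓ f.dom, hD.inf f.dense, inf_le_right, le_top, h⟩

lemma QMax.eq_zero_of_left (q : QMax Φ A) {I : Submodule Φ A} (hI : IsEssentialIdeal Φ I)
    (h : ∀ a ∈ I, QMax.of Φ A a * q = 0) : q = 0 := by
  obtain ⟨f⟩ := q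
  refine QMax.mk_eq_zero f hI.isDenseLeftIdeal fun d hd => ?_
  apply QMax.of_injective (Φ := Φ)
  rw [← QMax.of_mul_mk f hd.2, map_zero]
  exact h d hd.1

lemma QMax.eq_zero_of_right (q : QMax Φ A) {I : Submodule Φ A} (hI : IsEssentialIdeal Φ I)
    (h : ∀ a ∈ I, q * QMax.of Φ A a = 0) : q = 0 := by
  obtain ⟨f⟩ := q
  refine QMax.mk_eq_zero f f.dense fun d hd => hI.eq_zero_of_mul_right fun a ha => ?_
  apply QMax.of_injective (Φ := Φ)
  rw [map_mul, ← QMax.of_mul_mk f hd.2, map_zero, mul_assoc]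
  exact (congrArg _ (h a ha)).trans (mul_zero _)

lemma QMax.exists_of_compatible {I : Submodule Φ A} (hI : IsEssentialIdeal Φ I) (f g : A → A)
    (h : ∀ a ∈ I, ∀ b ∈ I, f a * b = a * g b) :
    ∃ q : QMax Φ A, ∀ a ∈ I, QMax.of Φ A a * q = QMax.of Φ A (f a) ∧
      q * QMax.of Φ A a = QMax.of Φ A (g a) := by
  let F : PartialHom Φ A :=
    { dom := I
      dense := hI.isDenseLeftIdeal
      toFun := f
      map_add := fun d hd e he => sub_eq_zero.1 <| hI.eq_zero_of_mul_right fun b hb => by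
        rw [sub_mul, add_mul, h d hd b hb, h e he b hb, h _ (I.add_mem hd he) b hb, add_mul,
          sub_self]
      map_smul := fun r d hd => sub_eq_zero.1 <| hI.eq_zero_of_mul_right fun b hb => by
        rw [sub_mul, smul_mul_assoc, h d hd b hb, h _ (I.smul_mem r hd) b hb, smul_mul_assoc,
          sub_self]
      map_mul := fun c d hd => sub_eq_zero.1 <| hI.eq_zero_of_mul_right fun b hb => by
        rw [sub_mul, mul_assoc, h d hd b hb, h _ (hI.1 c d hd).1 b hb, mul_assoc, sub_self] }
  refine ⟨QMax.mk F, fun a ha => ⟨QMax.of_mul_mk F ha, sub_eq_zero.1 ?_⟩⟩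
  refine QMax.eq_zero_of_left _ hI fun b hb => ?_
  have hF : QMax.of Φ A b * QMax.mk F = QMax.of Φ A (f b) := QMax.of_mul_mk F hb
  rw [mul_sub, ← mul_assoc, hF, ← map_mul, ← map_mul, h b hb a ha, sub_self]

variable (Φ A) in
theorem Qs.isSymmetricQuotient : IsSymmetricQuotient (Qs.of Φ A) where
  injective := Qs.of_injective Φ A
  exists_ideal := by
    rintro ⟨q, I, hI, h⟩
    refine ⟨I, hI, fun a ha => ?_⟩
    obtain ⟨⟨b, hb⟩, ⟨c, hc⟩⟩ := h a ha
    exact ⟨⟨b, Subtype.ext hb.symm⟩, ⟨c, Subtype.ext hc.symm⟩⟩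
  eq_zero_of_left q I hI h :=
    Subtype.ext (QMax.eq_zero_of_left q.1 hI fun a ha => congrArg Subtype.val (h a ha))
  eq_zero_of_right q I hI h :=
    Subtype.ext (QMax.eq_zero_of_right q.1 hI fun a ha => congrArg Subtype.val (h a ha))
  exists_of_compatible I hI f g h := by
    obtain ⟨q, hq⟩ := QMax.exists_of_compatible hI f g h
    exact ⟨⟨q, I, hI, fun a ha => ⟨⟨f a, (hq a ha).1.symm⟩, ⟨g a, (hq a ha).2.symm⟩⟩⟩,
      fun a ha => ⟨Subtype.ext (hq a ha).1, Subtype.ext (hq a ha).2⟩⟩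

end QMax

namespace IsSymmetricQuotient

section Uniqueness

variable {Φ : Type v} [CommRing Φ] {B : Type u} [NonUnitalRing B] [Module Φ B]
  [IsScalarTower Φ B B] [SMulCommClass Φ B B] [IsSemiprimeAlgebra Φ B]
  {S T : Type*} [NonUnitalRing S] [Module Φ S] [IsScalarTower Φ S S] [SMulCommClass Φ S S]
  [NonUnitalRing T] [Module Φ T] [IsScalarTower Φ T T] [SMulCommClass Φ T T]

/-- The elements `s` and `t` multiply some essential ideal of `B` into `B` in the same way. -/
def Related (σ : B →ₙₐ[Φ] S) (τ : B →ₙₐ[Φ] T) (s : S) (t : T) : Prop :=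
  ∃ I : Submodule Φ B, IsEssentialIdeal Φ I ∧
    ∀ a ∈ I, (∃ b, σ a * s = σ b ∧ τ a * t = τ b) ∧ ∃ b, s * σ a = σ b ∧ t * τ a = τ b

variable {σ : B →ₙₐ[Φ] S} {τ : B →ₙₐ[Φ] T}

lemma Related.symm {s : S} {t : T} (h : Related σ τ s t) : Related τ σ t s := by
  obtain ⟨I, hI, h⟩ := h
  refine ⟨I, hI, fun a ha => ?_⟩
  obtain ⟨⟨b, hb⟩, ⟨c, hc⟩⟩ := h a ha
  exact ⟨⟨b, hb.2, hb.1⟩, ⟨c, hc.2, hc.1⟩⟩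

variable (σ τ) in
lemma Related.base (b : B) : Related σ τ (σ b) (τ b) :=
  ⟨⊤, isEssentialIdeal_top, fun a _ => ⟨⟨a * b, by simp⟩, ⟨b * a, by simp⟩⟩⟩

lemma Related.add {s s' : S} {t t' : T} (h : Related σ τ s t) (h' : Related σ τ s' t') :
    Related σ τ (s + s') (t + t') := by
  obtain ⟨I, hI, h⟩ := h
  obtain ⟨J, hJ, h'⟩ := h'
  refine ⟨I ⊓ J, hI.inf hJ, fun a ha => ?_⟩
  obtain ⟨⟨b, hb⟩, ⟨c, hc⟩⟩ := h a ha.1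
  obtain ⟨⟨b', hb'⟩, ⟨c', hc'⟩⟩ := h' a ha.2
  exact ⟨⟨b + b', by simp [mul_add, hb, hb']⟩, ⟨c + c', by simp [add_mul, hc, hc']⟩⟩

lemma Related.smul {s : S} {t : T} (r : Φ) (h : Related σ τ s t) :
    Related σ τ (r • s) (r • t) := by
  obtain ⟨I, hI, h⟩ := h
  refine ⟨I, hI, fun a ha => ?_⟩
  obtain ⟨⟨b, hb⟩, ⟨c, hc⟩⟩ := h a ha
  exact ⟨⟨r • b, by simp [mul_smul_comm, hb]⟩, ⟨r • c, by simp [smul_mul_assoc, hc]⟩⟩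

lemma Related.mul {s s' : S} {t t' : T} (h : Related σ τ s t) (h' : Related σ τ s' t') :
    Related σ τ (s * s') (t * t') := by
  obtain ⟨I, hI, h⟩ := h
  obtain ⟨J, hJ, k⟩ := h'
  refine ⟨sqIdeal Φ (I ⊓ J), (hI.inf hJ).sq, fun z hz => ?_⟩
  induction hz using Submodule.span_induction with
  | mem z hz =>
    obtain ⟨a, ha, b, hb, rfl⟩ := hz
    obtain ⟨b', hb'⟩ := (h b hb.1).1
    obtain ⟨c, hc⟩ := (k (a * b') (hJ.1 b' a ha.2).2).1
    obtain ⟨a', ha'⟩ := (k a ha.2).2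
    obtain ⟨d, hd⟩ := (h (a' * b) (hI.1 a' b hb.1).1).2
    refine ⟨⟨c, ?_, ?_⟩, ⟨d, ?_, ?_⟩⟩
    · rw [← hc.1, map_mul, map_mul, ← hb'.1]; simp only [mul_assoc]
    · rw [← hc.2, map_mul, map_mul, ← hb'.2]; simp only [mul_assoc]
    · rw [← hd.1, map_mul, map_mul, ← ha'.1]; simp only [mul_assoc]
    · rw [← hd.2, map_mul, map_mul, ← ha'.2]; simp only [mul_assoc]
  | zero => exact ⟨⟨0, by simp⟩, ⟨0, by simp⟩⟩
  | add y z _ _ hy hz =>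
    obtain ⟨⟨b, hb⟩, ⟨c, hc⟩⟩ := hy
    obtain ⟨⟨b', hb'⟩, ⟨c', hc'⟩⟩ := hz
    exact ⟨⟨b + b', by simp [add_mul, hb, hb']⟩, ⟨c + c', by simp [mul_add, hc, hc']⟩⟩
  | smul r z _ hz =>
    obtain ⟨⟨b, hb⟩, ⟨c, hc⟩⟩ := hz
    exact ⟨⟨r • b, by simp [smul_mul_assoc, hb]⟩, ⟨r • c, by simp [mul_smul_comm, hc]⟩⟩

lemma Related.unique (hτ : IsSymmetricQuotient τ) (hσ : IsSymmetricQuotient σ) {s : S} {t t' : T}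
    (h : Related σ τ s t) (h' : Related σ τ s t') : t = t' := by
  obtain ⟨I, hI, h⟩ := h
  obtain ⟨J, hJ, h'⟩ := h'
  refine sub_eq_zero.1 (hτ.eq_zero_of_left _ _ (hI.inf hJ) fun a ha => ?_)
  obtain ⟨b, hb⟩ := (h a ha.1).1
  obtain ⟨b', hb'⟩ := (h' a ha.2).1
  have : b = b' := hσ.injective (hb.1.symm.trans hb'.1)
  rw [mul_sub, hb.2, hb'.2, this, sub_self]

lemma Related.exists_right (hτ : IsSymmetricQuotient τ) (hσ : IsSymmetricQuotient σ) (s : S) :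
    ∃ t, Related σ τ s t := by
  classical
  obtain ⟨I, hI, h⟩ := hσ.exists_ideal s
  choose! hl hr using h
  choose! f hf using hl
  choose! g hg using hr
  obtain ⟨t, ht⟩ := hτ.exists_of_compatible I hI f g fun a ha b hb => by
    apply hσ.injective
    rw [map_mul, map_mul, ← hf a ha, ← hg b hb, mul_assoc]
  exact ⟨t, I, hI, fun a ha => ⟨⟨f a, hf a ha, (ht a ha).1⟩, ⟨g a, hg a ha, (ht a ha).2⟩⟩⟩

/-- A symmetric algebra of quotients is unique up to an isomorphism over the base. -/
theorem exists_iso (hσ : IsSymmetricQuotient σ) (hτ : IsSymmetricQuotient τ) :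
    ∃ φ : S →ₙₐ[Φ] T, Function.Bijective φ ∧ ∀ b, φ (σ b) = τ b := by
  choose φ hφ using Related.exists_right hτ hσ
  have huniq : ∀ {s t}, Related σ τ s t → φ s = t := fun h => Related.unique hτ hσ (hφ _) h
  refine ⟨⟨⟨⟨φ, fun r s => huniq ((hφ s).smul r)⟩, ?_, fun s t => huniq ((hφ s).add (hφ t))⟩,
    fun s t => huniq ((hφ s).mul (hφ t))⟩, ⟨fun s s' h => ?_, fun t => ?_⟩,
    fun b => huniq (Related.base σ τ b)⟩
  · have := huniq (Related.base σ τ 0)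
    rwa [map_zero, map_zero] at this
  · have h' : φ s = φ s' := h
    exact Related.unique hσ hτ (hφ s).symm (h' ▸ (hφ s').symm)
  · obtain ⟨s, hs⟩ := Related.exists_right hσ hτ t
    exact ⟨s, huniq hs.symm⟩

end Uniqueness

section Local

variable {Φ : Type v} [CommRing Φ] {A : Type u} [NonUnitalRing A] [Module Φ A]
  [IsScalarTower Φ A A] [SMulCommClass Φ A A] [IsSemiprimeAlgebra Φ A]
  {Q : Type w} [Ring Q] [Algebra Φ Q] {ι : A →ₙₐ[Φ] Q}

lemma eq_zero_of_sandwich (hι : IsSymmetricQuotient ι) {K : Submodule Φ A}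
    (hK : IsEssentialIdeal Φ K) {q : Q} (h : ∀ k ∈ K, q * ι k * q = 0) : q = 0 := by
  obtain ⟨I, hI, hq⟩ := hι.exists_ideal q
  refine hι.eq_zero_of_left q _ (hI.inf hK) fun k hk => ?_
  obtain ⟨m, hm⟩ := (hq k hk.1).1
  rw [hm, Martindale.eq_zero_of_sandwich Φ (a := m) fun b => ?_, map_zero]
  apply hι.injective
  rw [map_mul, map_mul, ← hm, map_zero]
  calc ι k * q * ι b * (ι k * q) = ι k * (q * ι (b * k) * q) := by
        rw [map_mul]; simp only [mul_assoc]
    _ = 0 := by rw [h _ (hK.1 b k hk.2).1, mul_zero]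

variable {B : Type*} [NonUnitalRing B] [Module Φ B] [IsScalarTower Φ B B] [SMulCommClass Φ B B]
  [IsSemiprimeAlgebra Φ B] {T : Type*} [NonUnitalRing T] [Module Φ T]
  {x y : Q} {j : B →ₗ[Φ] Q} {k : T →ₗ[Φ] Q} {θ : B →ₙₐ[Φ] T}

/-- Two compatible maps `f`, `g` on an essential ideal of `xAx` come from an element of `xQx`. -/
lemma exists_of_compatible_local (hι : IsSymmetricQuotient ι) (hxy : x * y * x = x)
    (hl : ∀ a, ∃ b, x * ι a = ι b) (hr : ∀ a, ∃ b, ι a * x = ι b)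
    (hj : Function.Injective j) (hjx : ∀ b, ∃ a, j b = x * ι a * x)
    (hjs : ∀ a, ∃ b, j b = x * ι a * x) (hjm : ∀ b c, j (b * c) = j b * y * j c)
    {I : Submodule Φ B} (hI : IsEssentialIdeal Φ I) (f g : B → B)
    (hfg : ∀ a ∈ I, ∀ b ∈ I, f a * b = a * g b) :
    ∃ q : Q, x * y * q = q ∧ q * y * x = q ∧
      ∀ b ∈ I, j b * y * q = j (f b) ∧ q * y * j b = j (g b) := by
  have hxy' : x * (y * x) = x := by rw [← mul_assoc, hxy]
  have hjl : ∀ b, x * y * j b = j b := fun b => by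
    obtain ⟨a, ha⟩ := hjx b
    rw [ha]; simp only [← mul_assoc, hxy]
  have hjr : ∀ b, j b * y * x = j b := fun b => by
    obtain ⟨a, ha⟩ := hjx b
    rw [ha]; simp only [mul_assoc, hxy']
  have hjι : ∀ b, ∃ a, j b = ι a := fun b => by
    obtain ⟨a, ha⟩ := hjx b
    obtain ⟨a', ha'⟩ := hl a
    obtain ⟨a'', ha''⟩ := hr a'
    exact ⟨a'', by rw [ha, ha', ha'']⟩
  have hbax : ∀ b ∈ I, ∀ a, ∃ b' ∈ I, j b * ι a * x = j b' := fun b hb a => by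
    obtain ⟨c, hc⟩ := hjs a
    refine ⟨b * c, (hI.1 c b hb).2, ?_⟩
    rw [hjm, hc, ← mul_assoc, ← mul_assoc, hjr]
  have hxab : ∀ b ∈ I, ∀ a, ∃ b' ∈ I, x * ι a * j b = j b' := fun b hb a => by
    obtain ⟨c, hc⟩ := hjs a
    refine ⟨c * b, (hI.1 c b hb).1, ?_⟩
    rw [hjm, hc, mul_assoc _ y, mul_assoc _ x, ← mul_assoc x y, hjl]
  let M : Submodule Φ Q := Submodule.span Φ {m | ∃ a, ∃ b ∈ I, m = ι a * j b}
  let N : Submodule Φ Q := Submodule.span Φ {n | ∃ b ∈ I, ∃ a, n = j b * ι a}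
  have hM : ∀ c, ∀ m ∈ M, ι c * m ∈ M := fun c m hm => by
    induction hm using Submodule.span_induction with
    | mem m hm =>
      obtain ⟨a, b, hb, rfl⟩ := hm
      exact Submodule.subset_span ⟨c * a, b, hb, by rw [map_mul, mul_assoc]⟩
    | zero => simp
    | add m n _ _ hm hn => rw [mul_add]; exact M.add_mem hm hn
    | smul r m _ hm => rw [mul_smul_comm]; exact M.smul_mem r hm
  have hN : ∀ c, ∀ n ∈ N, n * ι c ∈ N := fun c n hn => by
    induction hn using Submodule.span_induction with
    | mem n hn =>
      obtain ⟨b, hb, a, rfl⟩ := hn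
      exact Submodule.subset_span ⟨b, hb, a * c, by rw [map_mul, mul_assoc]⟩
    | zero => simp
    | add m n _ _ hm hn => rw [add_mul]; exact N.add_mem hm hn
    | smul r m _ hm => rw [smul_mul_assoc]; exact N.smul_mem r hm
  let P : Q → Q → Prop := fun m z => z * y * x = z ∧ ∀ b ∈ I, z * y * j b = m * y * j (g b)
  have hP : ∀ m ∈ M, ∃ z, P m (ι z) := fun m hm => by
    induction hm using Submodule.span_induction with
    | mem m hm =>
      obtain ⟨a, b, hb, rfl⟩ := hm
      obtain ⟨c, hc⟩ := hjι (f b)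
      refine ⟨a * c, ?_, fun b' hb' => ?_⟩
      · rw [map_mul, ← hc, mul_assoc, mul_assoc, ← mul_assoc (j _), hjr]
      · rw [map_mul, ← hc]
        calc ι a * j (f b) * y * j b' = ι a * j (f b * b') := by
              rw [hjm]; simp only [mul_assoc]
          _ = ι a * j b * y * j (g b') := by
              rw [hfg b hb b' hb', hjm]; simp only [mul_assoc]
    | zero => exact ⟨0, by simp [P]⟩
    | add m n _ _ hm hn =>
      obtain ⟨z, hz⟩ := hm
      obtain ⟨z', hz'⟩ := hn
      refine ⟨z + z', ?_, fun b hb => ?_⟩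
      · rw [map_add, add_mul, add_mul, hz.1, hz'.1]
      · simp only [map_add, add_mul, hz.2 b hb, hz'.2 b hb]
    | smul r m _ hm =>
      obtain ⟨z, hz⟩ := hm
      refine ⟨r • z, ?_, fun b hb => ?_⟩
      · rw [map_smul, smul_mul_assoc, smul_mul_assoc, hz.1]
      · simp only [map_smul, smul_mul_assoc, hz.2 b hb]
  have hP' : ∀ n ∈ N, ∃ w, x * y * ι w = ι w ∧ ∀ m z, P m z → z * y * n = m * y * ι w :=
    fun n hn => by
    induction hn using Submodule.span_induction with
    | mem n hn =>
      obtain ⟨b, hb, a, rfl⟩ := hn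
      obtain ⟨c, hc⟩ := hjι (g b)
      refine ⟨c * a, ?_, fun m z hz => ?_⟩
      · rw [map_mul, ← hc, ← mul_assoc, hjl]
      · rw [map_mul, ← hc, ← mul_assoc, hz.2 b hb, ← mul_assoc]
    | zero => exact ⟨0, by simp⟩
    | add m n _ _ hm hn =>
      obtain ⟨w, hw, h⟩ := hm
      obtain ⟨w', hw', h'⟩ := hn
      refine ⟨w + w', ?_, fun m z hz => ?_⟩
      · rw [map_add, mul_add, hw, hw']
      · rw [map_add, mul_add, mul_add, h m z hz, h' m z hz]
    | smul r m _ hm =>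
      obtain ⟨w, hw, h⟩ := hm
      refine ⟨r • w, ?_, fun m z hz => ?_⟩
      · rw [map_smul, mul_smul_comm, hw]
      · rw [map_smul, mul_smul_comm, mul_smul_comm, h m z hz]
  let J : Submodule Φ A :=
    { carrier := {d | (ι d * x ∈ M ∧ ∀ a, ι d * ι a * x ∈ M) ∧
        x * ι d ∈ N ∧ ∀ a, x * ι a * ι d ∈ N}
      add_mem' := fun {d e} hd he => by
        simp only [Set.mem_ofPred_eq, map_add, add_mul, mul_add]
        exact ⟨⟨M.add_mem hd.1.1 he.1.1, fun a => M.add_mem (hd.1.2 a) (he.1.2 a)⟩,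
          N.add_mem hd.2.1 he.2.1, fun a => N.add_mem (hd.2.2 a) (he.2.2 a)⟩
      zero_mem' := by simp
      smul_mem' := fun r d hd => by
        simp only [Set.mem_ofPred_eq, map_smul, smul_mul_assoc, mul_smul_comm]
        exact ⟨⟨M.smul_mem r hd.1.1, fun a => M.smul_mem r (hd.1.2 a)⟩,
          N.smul_mem r hd.2.1, fun a => N.smul_mem r (hd.2.2 a)⟩ }
  have hJi : IsIdeal Φ J := fun c d hd => by
    refine ⟨⟨⟨?_, fun a => ?_⟩, ?_, fun a => ?_⟩, ⟨⟨?_, fun a => ?_⟩, ?_, fun a => ?_⟩⟩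
    · rw [map_mul, mul_assoc]; exact hM _ _ hd.1.1
    · rw [map_mul, mul_assoc, mul_assoc, ← mul_assoc (ι d)]; exact hM _ _ (hd.1.2 a)
    · rw [map_mul, ← mul_assoc]; exact hd.2.2 c
    · rw [mul_assoc, ← map_mul, ← mul_assoc a, map_mul, ← mul_assoc]; exact hd.2.2 _
    · rw [map_mul]; exact hd.1.2 c
    · rw [← map_mul, mul_assoc, map_mul]; exact hd.1.2 _
    · rw [map_mul, ← mul_assoc]; exact hN _ _ hd.2.1
    · rw [map_mul, ← mul_assoc]; exact hN _ _ (hd.2.2 a)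
  have hW : ∀ a c β, ∀ b ∈ I, j b = ι β → a * β * c ∈ J := fun a c β b hb hβ => by
    have h1 : ∀ c, ι a * j b * ι c * x ∈ M := fun c => by
      obtain ⟨b', hb', h⟩ := hbax b hb c
      exact Submodule.subset_span ⟨a, b', hb', by rw [← h]; simp only [mul_assoc]⟩
    have h2 : ∀ a, x * (ι a * j b * ι c) ∈ N := fun a => by
      obtain ⟨b', hb', h⟩ := hxab b hb a
      exact Submodule.subset_span ⟨b', hb', c, by rw [← h]; simp only [mul_assoc]⟩
    refine ⟨⟨?_, fun d => ?_⟩, ?_, fun d => ?_⟩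
    · rw [map_mul, map_mul, ← hβ]; exact h1 c
    · rw [map_mul, map_mul, ← hβ, mul_assoc _ (ι c), ← map_mul]; exact h1 _
    · rw [map_mul, map_mul, ← hβ]; exact h2 a
    · rw [map_mul, map_mul, ← hβ]
      simpa only [map_mul, mul_assoc] using h2 (d * a)
  have hJ : IsEssentialIdeal Φ J := by
    refine ⟨hJi, fun J' hJ' h0 hbot => h0 ((Submodule.eq_bot_iff _).2 fun p hp => ?_)⟩
    have hzero : ∀ d ∈ J, ∀ p ∈ J', d * p = 0 ∧ p * d = 0 := fun d hd p hp => by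
      have h1 : d * p ∈ J ⊓ J' := ⟨(hJi p d hd).2, (hJ' d p hp).1⟩
      have h2 : p * d ∈ J ⊓ J' := ⟨(hJi p d hd).1, (hJ' d p hp).2⟩
      rw [hbot, Submodule.mem_bot] at h1 h2
      exact ⟨h1, h2⟩
    have hβp : ∀ p ∈ J', ∀ b ∈ I, j b * ι p = 0 ∧ ι p * j b = 0 := fun p hp b hb => by
      obtain ⟨β, hβ⟩ := hjι b
      have h1 : ∀ c, β * c * p = 0 := fun c => Martindale.eq_zero_of_mul_left Φ fun a => by
        rw [← mul_assoc, ← mul_assoc]; exact (hzero _ (hW a c β b hb hβ) p hp).1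
      have h2 : ∀ c, p * c * β = 0 := fun c => Martindale.eq_zero_of_mul_right Φ fun a => by
        rw [mul_assoc, mul_assoc, ← mul_assoc c]; exact (hzero _ (hW c a β b hb hβ) p hp).2
      have h3 : β * p = 0 := Martindale.eq_zero_of_sandwich Φ fun c => by
        have := h1 (p * c * β)
        simpa only [mul_assoc] using this
      have h4 : p * β = 0 := Martindale.eq_zero_of_sandwich Φ fun c => by
        have := h2 (β * c * p)
        simpa only [mul_assoc] using this
      rw [hβ, ← map_mul, ← map_mul, h3, h4, map_zero]
      exact ⟨rfl, rfl⟩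
    have hx : ∀ p ∈ J', ι p * x = 0 ∧ x * ι p = 0 := fun p hp => by
      have h1 : ∀ c, x * ι (c * p) * x = 0 := fun c => by
        obtain ⟨b', hb'⟩ := hjs (c * p)
        have : b' = 0 := hI.eq_zero_of_mul_right fun b hb => hj (by
          rw [hjm, hb', map_zero, mul_assoc _ y, mul_assoc _ x, ← mul_assoc x y, hjl, map_mul,
            mul_assoc, mul_assoc, (hβp p hp b hb).2, mul_zero, mul_zero])
        rw [← hb', this, map_zero]
      have h2 : ∀ c, x * ι (p * c) * x = 0 := fun c => by
        obtain ⟨b', hb'⟩ := hjs (p * c)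
        have : b' = 0 := hI.eq_zero_of_mul_left fun b hb => hj (by
          rw [hjm, hb', map_zero, ← mul_assoc, ← mul_assoc, hjr, map_mul, ← mul_assoc,
            (hβp p hp b hb).1, zero_mul, zero_mul])
        rw [← hb', this, map_zero]
      constructor
      · refine hι.eq_zero_of_sandwich isEssentialIdeal_top fun c _ => ?_
        have := h1 c
        rw [map_mul] at this
        calc ι p * x * ι c * (ι p * x) = ι p * (x * (ι c * ι p) * x) := by simp only [mul_assoc]
          _ = 0 := by rw [this, mul_zero]
      · refine hι.eq_zero_of_sandwich isEssentialIdeal_top fun c _ => ?_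
        have := h2 c
        rw [map_mul] at this
        calc x * ι p * ι c * (x * ι p) = x * (ι p * ι c) * x * ι p := by simp only [mul_assoc]
          _ = 0 := by rw [this, zero_mul]
    have hpJ : p ∈ J := by
      refine ⟨⟨?_, fun a => ?_⟩, ?_, fun a => ?_⟩
      · rw [(hx p hp).1]; exact M.zero_mem
      · rw [← map_mul, (hx _ (hJ' a p hp).2).1]; exact M.zero_mem
      · rw [(hx p hp).2]; exact N.zero_mem
      · rw [mul_assoc, ← map_mul, (hx _ (hJ' a p hp).1).2]; exact N.zero_mem
    have : p ∈ J ⊓ J' := ⟨hpJ, hp⟩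
    rwa [hbot, Submodule.mem_bot] at this
  have hF : ∀ d ∈ J, ∃ z, P (ι d * x) (ι z) := fun d hd => hP _ hd.1.1
  have hG : ∀ d ∈ J, ∃ w, x * y * ι w = ι w ∧ ∀ m z, P m z → z * y * (x * ι d) = m * y * ι w :=
    fun d hd => hP' _ hd.2.1
  choose! F hF using hF
  choose! G hG hG' using hG
  obtain ⟨q, hq⟩ := hι.exists_of_compatible J hJ F G fun d hd d' hd' => by
    apply hι.injective
    have := hG' d' hd' _ _ (hF d hd)
    rw [← mul_assoc, (hF d hd).1, mul_assoc (ι d), mul_assoc (ι d), hG d' hd'] at this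
    rw [map_mul, map_mul, this]
  refine ⟨q, ?_, ?_, fun b hb => ⟨?_, ?_⟩⟩
  · refine sub_eq_zero.1 (hι.eq_zero_of_right _ J hJ fun d hd => ?_)
    rw [sub_mul, mul_assoc, (hq d hd).2, hG d hd, sub_self]
  · refine sub_eq_zero.1 (hι.eq_zero_of_left _ J hJ fun d hd => ?_)
    rw [mul_sub, ← mul_assoc, ← mul_assoc, (hq d hd).1, (hF d hd).1, sub_self]
  · refine sub_eq_zero.1 (hι.eq_zero_of_right _ J hJ fun d hd => ?_)
    have := hG' d hd (j b) (j (f b)) ⟨hjr _, fun b' hb' => by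
      rw [← hjm, hfg b hb b' hb', hjm]⟩
    rw [sub_mul, mul_assoc, (hq d hd).2, ← this, ← mul_assoc, hjr, sub_self]
  · refine sub_eq_zero.1 (hι.eq_zero_of_left _ J hJ fun d hd => ?_)
    rw [mul_sub, ← mul_assoc, ← mul_assoc, (hq d hd).1, (hF d hd).2 b hb, mul_assoc (ι d),
      mul_assoc (ι d), hjl, sub_self]

/-- If `x = xyx` then the local algebra `xQx` is a symmetric algebra of quotients of `xAx`. -/
theorem local_of_regular (hι : IsSymmetricQuotient ι) (hxy : x * y * x = x)
    (hl : ∀ a, ∃ b, x * ι a = ι b) (hr : ∀ a, ∃ b, ι a * x = ι b)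
    (hj : Function.Injective j) (hjx : ∀ b, ∃ a, j b = x * ι a * x)
    (hjs : ∀ a, ∃ b, j b = x * ι a * x) (hjm : ∀ b c, j (b * c) = j b * y * j c)
    (hk : Function.Injective k) (hkx : ∀ t, ∃ q, k t = x * q * x)
    (hks : ∀ q, ∃ t, k t = x * q * x) (hkm : ∀ s t, k (s * t) = k s * y * k t)
    (hθ : ∀ b, k (θ b) = j b) : IsSymmetricQuotient θ := by
  have hxy' : x * (y * x) = x := by rw [← mul_assoc, hxy]
  have hkl : ∀ t, x * y * k t = k t := fun t => by
    obtain ⟨a, ha⟩ := hkx t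
    rw [ha]; simp only [← mul_assoc, hxy]
  have hkr : ∀ t, k t * y * x = k t := fun t => by
    obtain ⟨a, ha⟩ := hkx t
    rw [ha]; simp only [mul_assoc, hxy']
  have hprod : ∀ p p', x * p * x * y * (x * p' * x) = x * p * x * p' * x := fun p p' => by
    calc x * p * x * y * (x * p' * x) = x * p * (x * y * x) * p' * x := by simp only [mul_assoc]
      _ = x * p * x * p' * x := by rw [hxy]
  refine ⟨fun b c h => hj ?_, fun t => ?_, fun t I hI h => ?_, fun t I hI h => ?_,
    fun I hI f g hfg => ?_⟩
  · rw [← hθ, ← hθ, h]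
  · obtain ⟨p, hp⟩ := hkx t
    obtain ⟨K₁, hK₁, h₁⟩ := hι.exists_ideal (x * p)
    obtain ⟨K₂, hK₂, h₂⟩ := hι.exists_ideal (p * x)
    have hK := hK₁.inf hK₂
    let I : Submodule Φ B :=
      { carrier := {b | ∃ c ∈ K₁ ⊓ K₂, j b = x * ι c * x}
        add_mem' := by
          rintro b b' ⟨c, hc, h⟩ ⟨c', hc', h'⟩
          exact ⟨c + c', add_mem hc hc', by rw [map_add, map_add, h, h', mul_add, add_mul]⟩
        zero_mem' := ⟨0, zero_mem _, by simp⟩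
        smul_mem' := by
          rintro r b ⟨c, hc, h⟩
          exact ⟨r • c, Submodule.smul_mem _ r hc, by simp [h]⟩ }
    have hIi : IsIdeal Φ I := by
      rintro a b ⟨c, hc, h⟩
      obtain ⟨d, hd⟩ := hjx a
      obtain ⟨d₁, hd₁⟩ := hl d
      obtain ⟨d₂, hd₂⟩ := hr d
      refine ⟨⟨d₂ * c, (hK.1 _ _ hc).1, ?_⟩, ⟨c * d₁, (hK.1 _ _ hc).2, ?_⟩⟩
      · rw [hjm, hd, h, hprod, map_mul, ← hd₂]; simp only [mul_assoc]
      · rw [hjm, hd, h, hprod, map_mul, ← hd₁]; simp only [mul_assoc]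
    refine ⟨I, hIi.isEssentialIdeal fun b hb => hj ?_, ?_⟩
    · rw [map_zero]
      refine hι.eq_zero_of_sandwich hK fun c hc => ?_
      obtain ⟨d, hd⟩ := hjx b
      obtain ⟨b', hb'⟩ := hjs c
      have h := congrArg j (hb b' ⟨c, hc, hb'⟩)
      rw [hjm, hb', hd, hprod, map_zero] at h
      calc j b * ι c * j b = x * ι d * x * ι c * x * ι d * x := by
            rw [hd]; simp only [mul_assoc]
        _ = 0 := by rw [h, zero_mul, zero_mul]
    · rintro b ⟨c, hc, hb⟩
      obtain ⟨m₁, hm₁⟩ := (h₁ c hc.1).1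
      obtain ⟨m₂, hm₂⟩ := (h₂ c hc.2).2
      obtain ⟨b₁, hb₁⟩ := hjs m₁
      obtain ⟨b₂, hb₂⟩ := hjs m₂
      refine ⟨⟨b₁, hk ?_⟩, ⟨b₂, hk ?_⟩⟩
      · rw [hkm, hθ, hθ, hb, hp, hb₁, hprod, ← hm₁]; simp only [mul_assoc]
      · rw [hkm, hθ, hθ, hb, hp, hb₂, hprod, ← hm₂]; simp only [mul_assoc]
  · apply hk
    rw [map_zero]
    obtain ⟨p, hp⟩ := hkx t
    obtain ⟨K, hK, hpK⟩ := hι.exists_ideal (p * x)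
    refine hι.eq_zero_of_sandwich hK fun c hc => ?_
    obtain ⟨m, hm⟩ := (hpK c hc).2
    obtain ⟨b, hb⟩ := hjs m
    have hb' : j b = k t * ι c * x := by rw [hb, ← hm, hp]; simp only [mul_assoc]
    have hb0 : b = 0 := hI.eq_zero_of_mul_left fun a ha => hj (by
      have := congrArg k (h a ha)
      rw [hkm, hθ, map_zero] at this
      rw [hjm, hb', ← mul_assoc, ← mul_assoc, this, zero_mul, zero_mul, map_zero])
    rw [hb0, map_zero] at hb'
    calc k t * ι c * k t = k t * ι c * x * (p * x) := by
          nth_rw 2 [hp]; simp only [mul_assoc]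
      _ = 0 := by rw [← hb', zero_mul]
  · apply hk
    rw [map_zero]
    obtain ⟨p, hp⟩ := hkx t
    obtain ⟨K, hK, hpK⟩ := hι.exists_ideal (x * p)
    refine hι.eq_zero_of_sandwich hK fun c hc => ?_
    obtain ⟨m, hm⟩ := (hpK c hc).1
    obtain ⟨b, hb⟩ := hjs m
    have hb' : j b = x * ι c * k t := by rw [hb, ← hm, hp]; simp only [mul_assoc]
    have hb0 : b = 0 := hI.eq_zero_of_mul_right fun a ha => hj (by
      have := congrArg k (h a ha)
      rw [hkm, hθ, map_zero] at this
      rw [hjm, hb', mul_assoc _ y, mul_assoc _ (k t), ← mul_assoc (k t), this, mul_zero,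
        map_zero])
    rw [hb0, map_zero] at hb'
    calc k t * ι c * k t = x * p * (x * ι c * k t) := by
          nth_rw 1 [hp]; simp only [mul_assoc]
      _ = 0 := by rw [← hb', mul_zero]
  · obtain ⟨q, hq₁, hq₂, hq⟩ :=
      hι.exists_of_compatible_local hxy hl hr hj hjx hjs hjm hI f g hfg
    obtain ⟨t, ht⟩ := hks (y * q * y)
    have ht' : k t = q := by
      rw [ht, ← mul_assoc, ← mul_assoc, hq₁, hq₂]
    refine ⟨t, fun a ha => ⟨hk ?_, hk ?_⟩⟩
    · rw [hkm, hθ, hθ, ht', (hq a ha).1]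
    · rw [hkm, hθ, hθ, ht', (hq a ha).2]

end Local

end IsSymmetricQuotient

/-! ## Local algebras and corners of `Q_s(A)` -/

section Main

variable {Φ : Type v} [CommRing Φ] {A : Type u} [NonUnitalRing A] [Module Φ A]
  [IsScalarTower Φ A A] [SMulCommClass Φ A A] [IsSemiprimeAlgebra Φ A]

theorem Qs.exists_iso_local {B : Type*} [NonUnitalRing B] [Module Φ B] [IsScalarTower Φ B B]
    [SMulCommClass Φ B B] [IsSemiprimeAlgebra Φ B] {T : Type*} [NonUnitalRing T] [Module Φ T]
    [IsScalarTower Φ T T] [SMulCommClass Φ T T]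
    {x y : Qs Φ A} (hxy : x * y * x = x) (hx : Absorbs (Qs.base Φ A) x)
    (j : B →ₗ[Φ] Qs Φ A) (k : T →ₗ[Φ] Qs Φ A)
    (hj : Function.Injective j) (hjx : ∀ b, ∃ a ∈ Qs.base Φ A, j b = x * a * x)
    (hjs : ∀ a ∈ Qs.base Φ A, ∃ b, j b = x * a * x) (hjm : ∀ b c, j (b * c) = j b * y * j c)
    (hk : Function.Injective k) (hkx : ∀ t, ∃ q, k t = x * q * x)
    (hks : ∀ q, ∃ t, k t = x * q * x) (hkm : ∀ s t, k (s * t) = k s * y * k t) :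
    ∃ φ : Qs Φ B →ₙₐ[Φ] T, Function.Bijective φ ∧ ∀ b, k (φ (Qs.of Φ B b)) = j b := by
  have hjk : ∀ b, ∃ t, k t = j b := fun b => by
    obtain ⟨a, -, ha⟩ := hjx b
    obtain ⟨t, ht⟩ := hks a
    exact ⟨t, ht.trans ha.symm⟩
  choose θ hθ using hjk
  let θ' : B →ₙₐ[Φ] T :=
    { toFun := θ
      map_smul' := fun r b => hk (by simp [hθ])
      map_zero' := hk (by simp [hθ])
      map_add' := fun b c => hk (by simp [hθ])
      map_mul' := fun b c => hk (by simp [hθ, hkm, hjm]) }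
  have hsym : IsSymmetricQuotient θ' := by
    refine (Qs.isSymmetricQuotient Φ A).local_of_regular (j := j) (k := k) hxy (fun a => ?_)
      (fun a => ?_) hj (fun b => ?_) (fun a => hjs _ ⟨a, rfl⟩) hjm hk hkx hks hkm hθ
    · obtain ⟨b, hb⟩ := (hx (Qs.of Φ A a) ⟨a, rfl⟩).1
      exact ⟨b, hb.symm⟩
    · obtain ⟨b, hb⟩ := (hx (Qs.of Φ A a) ⟨a, rfl⟩).2
      exact ⟨b, hb.symm⟩
    · obtain ⟨_, ⟨a, rfl⟩, ha⟩ := hjx b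
      exact ⟨a, ha⟩
  obtain ⟨φ, hφ, h⟩ := (Qs.isSymmetricQuotient Φ B).exists_iso hsym
  exact ⟨φ, hφ, fun b => by rw [h]; exact hθ b⟩

lemma LocalAlgebra.val_mk_mul_mk {Q : Type u} [Ring Q] [Algebra Φ Q]
    {S : NonUnitalSubalgebra Φ Q} {x : Q} (hx : Absorbs S x) (s t : Q) (hs : s ∈ S) (ht : t ∈ S) :
    val (mk hx s hs * mk hx t ht) = x * s * x * t * x := by
  rw [val_mul_left, val_mk]

lemma LocalAlgebra.val_mul_of_regular {Q : Type u} [Ring Q] [Algebra Φ Q]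
    {S : NonUnitalSubalgebra Φ Q} {x y : Q} (hxy : x * y * x = x) {hx : Absorbs S x}
    (a b : LocalAlgebra S x hx) : val (a * b) = val a * y * val b := by
  obtain ⟨s, hs, rfl⟩ := exists_mk a
  obtain ⟨t, ht, rfl⟩ := exists_mk b
  rw [val_mk_mul_mk, val_mk, val_mk]
  calc x * s * x * t * x = x * s * (x * y * x) * t * x := by rw [hxy]
    _ = x * s * x * y * (x * t * x) := by simp only [mul_assoc]

/-- If `x Q_s(A) x` has an identity element then `x` is von Neumann regular. -/
lemma Qs.isVonNeumannRegular_of_local_one {x : Qs Φ A}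
    (u : LocalAlgebra (⊤ : NonUnitalSubalgebra Φ (Qs Φ A)) x (absorbs_top x))
    (hu : ∀ t, u * t = t ∧ t * u = t) : IsVonNeumannRegular x := by
  obtain ⟨y, hy, rfl⟩ := LocalAlgebra.exists_mk u
  have h1 : ∀ q : Qs Φ A, x * y * x * q * x = x * q * x := fun q => by
    have := congrArg LocalAlgebra.val (hu (LocalAlgebra.mk (absorbs_top x) q trivial)).1
    exact (LocalAlgebra.val_mk_mul_mk (absorbs_top x) y q hy trivial).symm.trans this
  have h2 : ∀ q : Qs Φ A, x * q * x * y * x = x * q * x := fun q => by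
    have := congrArg LocalAlgebra.val (hu (LocalAlgebra.mk (absorbs_top x) q trivial)).2
    exact (LocalAlgebra.val_mk_mul_mk (absorbs_top x) q y trivial hy).symm.trans this
  refine ⟨y, (sub_eq_zero.1 ?_).symm⟩
  refine (Qs.isSymmetricQuotient Φ A).eq_zero_of_sandwich isEssentialIdeal_top fun c _ => ?_
  calc (x * y * x - x) * Qs.of Φ A c * (x * y * x - x)
      = (x * y * x * Qs.of Φ A c * x - x * Qs.of Φ A c * x) * (y * x - 1) := by noncomm_ring
    _ = 0 := by rw [h1, sub_self, zero_mul]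

theorem Qs.exists_iso_localAlgebra {x : Qs Φ A} (hx : Absorbs (Qs.base Φ A) x)
    (hreg : IsVonNeumannRegular x) :
    ∃ φ : Qs Φ (LocalAlgebra (Qs.base Φ A) x hx) →ₙₐ[Φ]
        LocalAlgebra (⊤ : NonUnitalSubalgebra Φ (Qs Φ A)) x (absorbs_top x),
      Function.Bijective φ ∧ ∀ a : LocalAlgebra (Qs.base Φ A) x hx,
        LocalAlgebra.val (φ (Qs.of Φ _ a)) = LocalAlgebra.val a := by
  obtain ⟨y, hy⟩ := hreg
  exact Qs.exists_iso_local hy.symm hx LocalAlgebra.val LocalAlgebra.val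
    LocalAlgebra.val_injective
    (fun b => by
      obtain ⟨s, hs, rfl⟩ := LocalAlgebra.exists_mk b
      exact ⟨s, hs, rfl⟩)
    (fun a ha => ⟨LocalAlgebra.mk _ a ha, rfl⟩)
    (LocalAlgebra.val_mul_of_regular hy.symm) LocalAlgebra.val_injective
    (fun b => by
      obtain ⟨s, hs, rfl⟩ := LocalAlgebra.exists_mk b
      exact ⟨s, rfl⟩)
    (fun q => ⟨LocalAlgebra.mk _ q trivial, rfl⟩)
    (LocalAlgebra.val_mul_of_regular hy.symm)

lemma corner_mul {Q : Type u} [Ring Q] [Algebra Φ Q] {S : NonUnitalSubalgebra Φ Q} {e : Q}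
    {hid : IsIdempotentElem e} {he : Absorbs S e} (a b : corner S e hid he) :
    ((a * b : corner S e hid he) : Q) = a * e * b := by
  obtain ⟨_, s, hs, rfl⟩ := a
  have : e * s * e * e = e * s * e := by rw [mul_assoc, hid.eq]
  exact congrArg (· * (b : Q)) this.symm

theorem Qs.exists_iso_corner {e : Qs Φ A} (hid : IsIdempotentElem e)
    (he : Absorbs (Qs.base Φ A) e) :
    ∃ φ : Qs Φ (corner (Qs.base Φ A) e hid he) →ₙₐ[Φ]
        corner (⊤ : NonUnitalSubalgebra Φ (Qs Φ A)) e hid (absorbs_top e),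
      Function.Bijective φ ∧ ∀ a : corner (Qs.base Φ A) e hid he,
        ((φ (Qs.of Φ _ a) : corner (⊤ : NonUnitalSubalgebra Φ (Qs Φ A)) e hid (absorbs_top e)) :
          Qs Φ A) = (a : Qs Φ A) := by
  have hee : e * e * e = e := by rw [hid.eq, hid.eq]
  exact Qs.exists_iso_local (B := corner (Qs.base Φ A) e hid he)
    (T := corner (⊤ : NonUnitalSubalgebra Φ (Qs Φ A)) e hid (absorbs_top e)) hee he
    (corner (Qs.base Φ A) e hid he).toSubmodule.subtype
    (corner (⊤ : NonUnitalSubalgebra Φ (Qs Φ A)) e hid (absorbs_top e)).toSubmodule.subtype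
    Subtype.val_injective (fun b => b.2) (fun a ha => ⟨⟨_, a, ha, rfl⟩, rfl⟩) corner_mul
    Subtype.val_injective (fun b => ⟨b.2.choose, b.2.choose_spec.2⟩)
    (fun q => ⟨⟨_, q, trivial, rfl⟩, rfl⟩) corner_mul

end Main

end Martindale

end

theorem mainTheorem2 {Φ : Type*} [CommRing Φ] {A : Type*} [NonUnitalRing A]
    [Module Φ A] [IsScalarTower Φ A A] [SMulCommClass Φ A A] [Martindale.IsSemiprimeAlgebra Φ A] :
    (∀ (x : Martindale.Qs Φ A) (hx : Martindale.Absorbs (Martindale.Qs.base Φ A) x),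
      Martindale.IsVonNeumannRegular x ↔
        ∃ φ : Martindale.Qs Φ (Martindale.LocalAlgebra (Martindale.Qs.base Φ A) x hx) →ₙₐ[Φ]
            Martindale.LocalAlgebra (⊤ : NonUnitalSubalgebra Φ (Martindale.Qs Φ A)) x
              (Martindale.absorbs_top x),
          Function.Bijective φ ∧
            ∀ a : Martindale.LocalAlgebra (Martindale.Qs.base Φ A) x hx,
              Martindale.LocalAlgebra.val (φ (Martindale.Qs.of Φ _ a)) =
                Martindale.LocalAlgebra.val a) ∧
    (∀ (e : Martindale.Qs Φ A) (hid : IsIdempotentElem e)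
        (he : Martindale.Absorbs (Martindale.Qs.base Φ A) e),
      ∃ φ : Martindale.Qs Φ (Martindale.corner (Martindale.Qs.base Φ A) e hid he) →ₙₐ[Φ]
          Martindale.corner (⊤ : NonUnitalSubalgebra Φ (Martindale.Qs Φ A)) e
            hid (Martindale.absorbs_top e),
        Function.Bijective φ ∧
          ∀ a : Martindale.corner (Martindale.Qs.base Φ A) e hid he,
            ((φ (Martindale.Qs.of Φ _ a) : Martindale.corner (⊤ : NonUnitalSubalgebra Φ
                (Martindale.Qs Φ A)) e hid (Martindale.absorbs_top e)) : Martindale.Qs Φ A) =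
              (a : Martindale.Qs Φ A)) := by
  refine ⟨fun x hx => ⟨Martindale.Qs.exists_iso_localAlgebra hx, ?_⟩,
    fun e hid he => Martindale.Qs.exists_iso_corner hid he⟩
  rintro ⟨φ, ⟨-, hsurj⟩, -⟩
  refine Martindale.Qs.isVonNeumannRegular_of_local_one (φ 1) fun t => ?_
  obtain ⟨s, rfl⟩ := hsurj t
  rw [← map_mul, ← map_mul, one_mul, mul_one]
  exact ⟨rfl, rfl⟩
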